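/- Let $q\in\mathbb{C}$ with $0<|q|<0.206783$, and write $(a;q)_n=\prod_{k=0}^{n-1}(1-aq^k)$ and $\sigma_\alpha(m)=\sum_{d\mid m}d^\alpha$; let $\left\{{n\atop k}\right\}$ be the Stirling numbers of the second kind. For nonzero $a,b$ put $$\mathrm{ab}_i(a,b;q)=\frac{q^{2i-4}(1-bq^{i-3})(1-aq^{i-2})(a-bq^{i-2})(1-q^{i-1})}{(1-bq^{2i-5})(1-bq^{2i-4})^2(1-bq^{2i-3})}\quad(i\ge2),\qquad c_1(a,b;q)=\frac{a-1}{b-1},$$ $$c_i(a,b;q)=\frac{q^{i-2}\bigl(q+abq^{2i-3}+a(1-q^{i-1}-q^i)+bq^{i-2}(-1-q+q^i)\bigr)}{(1-bq^{2i-4})(1-bq^{2i-2})}\quad(i\ge 2),$$ and let $\mathrm{ab}_i,c_i$ denote these quantities at $(a,b)=(q,q^2)$. These are the parameters of the J-fraction $\cfrac{1}{1-c_1z-\cfrac{\mathrm{ab}_2z^2}{1-c_2z-\cdots}}$ of $(1-q)\sum_{n\ge0}\frac{z^n}{1-q^{n+1}}$. Its convergent denominators are $Q_0=1$, $Q_1=1-c_1z$,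 $Q_h=(1-c_hz)Q_{h-1}-\mathrm{ab}_hz^2Q_{h-2}$ for $h\ge2$. Define the Stirling $q$-coefficients by $\left[{0\atop0}\right]=1$, $\left[{0\atop k}\right]=0$ for $k\neq0$, $\left[{h\atop k}\right]=\left[{h-1\atop k}\right]-c_h\left[{h-1\atop k-1}\right]$ for $h\ge1$ (zero for $k<0$), and the power series in $z$ $$S_{h,m,s}(z)=\sum\ \prod_{i=1}^m\frac{\mathrm{ab}_{k_i}}{(1-c_{k_i}z)(1-c_{k_i-1}z)},$$ the sum being over integers $2\le k_1,\dots,k_m\le h$ with $k_{i}+2\le k_{i+1}$ and $k_1+\cdots+k_m=s$. Put $$d_{h,n}=\left[{h\atop n}\right]+\sum_{m=1}^{\lfloor h/2\rfloor}\sum_{s=0}^{mh}\sum_{k=0}^{n}(-1)^m\left[{h\atop n-k}\right][z^{k-2m}]S_{h,m,s}(z),\qquad \widetilde D_{0,j}(q,z)=\sum_{n=0}^{2j+1}\Bigl(\sum_{k=0}^n d_{j,k}\,d_{j+1,n-k}\Bigr)z^n,$$ (with $[z^r]S=0$ for $r<0$) and $$K_j(q)=\frac{q^{j^2}(q;q)_j^4}{(q;q^2)_j^2(q^2;q^2)_j^2(1-q^{2j+1})}.$$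 **Proposition.** For all $j\ge1$ one has $\widetilde D_{0,j}(q,z)=Q_j(q,z)Q_{j+1}(q,z)$ for all $z\in\mathbb{C}$, and $\widetilde D_{0,j}(q,q)\ne0$. For every integer $\alpha\ge1$, with $D^{(i)}$ the $i$-th derivative in $z$, $$\sum_{m\ge1}\sigma_\alpha(m)q^m=\sum_{n\ge1}\frac{n^\alpha q^n}{1-q^n} =\sum_{i=0}^\alpha\left\{{\alpha\atop i}\right\}\left(z^iD^{(i)}\!\left[\frac{z(1+q)}{(1-q)(1+q-z)}\right]+\sum_{j\ge1}K_j(q)\,z^iD^{(i)}\!\left[\frac{z^{2j+1}}{\widetilde D_{0,j}(q,z)}\right]\right)\Bigg|_{z=q}$$ $$=\sum_{i=0}^\alpha\left\{{\alpha+1\atop i+1}\right\}\left(\frac{z^i\,i!\,q(1+q)}{(1-q)(1+q-z)^{i+1}}+\sum_{j\ge1}q\,K_j(q)\,z^iD^{(i)}\!\left[\frac{z^{2j}}{\widetilde D_{0,j}(q,z)}\right]\right)\Bigg|_{z=q},$$ where all infinite series converge absolutely, those over $j$ for each $i\ge0$. -/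

import Mathlib

noncomputable section

namespace JFrac

/-- The finite `q`-Pochhammer symbol `(a; q)_n = (1 - a)(1 - a q) ⋯ (1 - a q^(n-1))`. -/
def qPoch (a q : ℂ) (n : ℕ) : ℂ := ∏ k ∈ Finset.range n, (1 - a * q ^ k)

/-- The J-fraction parameters `ab_i(a, b; q)`, used for `i ≥ 2`. -/
def abSeq (a b q : ℂ) (i : ℕ) : ℂ :=
  q ^ (2 * (i : ℤ) - 4) * (1 - b * q ^ ((i : ℤ) - 3)) * (1 - a * q ^ ((i : ℤ) - 2)) *
      (a - b * q ^ ((i : ℤ) - 2)) * (1 - q ^ ((i : ℤ) - 1)) /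
    ((1 - b * q ^ (2 * (i : ℤ) - 5)) * (1 - b * q ^ (2 * (i : ℤ) - 4)) ^ 2 *
      (1 - b * q ^ (2 * (i : ℤ) - 3)))

/-- The J-fraction parameters `c_i(a, b; q)`, used for `i ≥ 1`. -/
def cSeq (a b q : ℂ) (i : ℕ) : ℂ :=
  if 2 ≤ i then
    q ^ ((i : ℤ) - 2) *
        (q + a * b * q ^ (2 * (i : ℤ) - 3) + a * (1 - q ^ ((i : ℤ) - 1) - q ^ (i : ℤ)) +
          b * q ^ ((i : ℤ) - 2) * (-1 - q + q ^ (i : ℤ))) /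
      ((1 - b * q ^ (2 * (i : ℤ) - 4)) * (1 - b * q ^ (2 * (i : ℤ) - 2)))
  else if i = 1 then (a - 1) / (b - 1)
  else 0

/-- The denominators `Q_h(z)` of the convergents of the J-fraction
`1 / (1 - c_1 z - ab_2 z^2 / (1 - c_2 z - ab_3 z^2 / ⋯))`. -/
def convDenom (c ab : ℕ → ℂ) (z : ℂ) : ℕ → ℂ
  | 0 => 1
  | 1 => 1 - c 1 * z
  | h + 2 => (1 - c (h + 2) * z) * convDenom c ab z (h + 1) - ab (h + 2) * z ^ 2 * convDenom c ab z h

/-- The Stirling `q`-coefficients attached to the sequence `c`, by their triangular recurrence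
`[h, k] = [h-1, k] - c_h [h-1, k-1]`, with `[0, 0] = 1`. -/
def stirlingQ (c : ℕ → ℂ) : ℕ → ℕ → ℂ
  | 0, 0 => 1
  | 0, _ + 1 => 0
  | h + 1, 0 => stirlingQ c h 0
  | h + 1, k + 1 => stirlingQ c h (k + 1) - c (h + 1) * stirlingQ c h k

/-- The nested sums `S_{h,m,s}(z)`, as formal power series in `z`: the sum over all
`2 ≤ k_1, k_1 + 2 ≤ k_2, …, k_{m-1} + 2 ≤ k_m ≤ h` with `k_1 + ⋯ + k_m = s` of the products of
`ab_{k_i} / ((1 - c_{k_i} z)(1 - c_{k_i - 1} z))`. -/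
def nestedSum (c ab : ℕ → ℂ) (h m s : ℕ) : PowerSeries ℂ :=
  ∑ k ∈ (Fintype.piFinset (fun _ : Fin m => Finset.Icc 2 h)).filter
      (fun k => (∀ i j : Fin m, i < j → k i + 2 ≤ k j) ∧ ∑ i, k i = s),
    ∏ i : Fin m,
      (PowerSeries.C (ab (k i)) * (1 - PowerSeries.C (c (k i)) * PowerSeries.X)⁻¹ *
        (1 - PowerSeries.C (c (k i - 1)) * PowerSeries.X)⁻¹)

/-- The expansion of the coefficient `[z^n] Q_h(z)` in Stirling `q`-coefficients and nested sums;
a coefficient `[z^(k - 2m)]` with `k < 2m` is zero. -/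
def denomCoeff (c ab : ℕ → ℂ) (h n : ℕ) : ℂ :=
  stirlingQ c h n +
    ∑ m ∈ Finset.Icc 1 (h / 2), ∑ s ∈ Finset.range (m * h + 1), ∑ k ∈ Finset.range (n + 1),
      (-1) ^ m * stirlingQ c h (n - k) *
        (if 2 * m ≤ k then PowerSeries.coeff (k - 2 * m) (nestedSum c ab h m s) else 0)

/-- The polynomial `D̃_{0,j}(q, z)`, of degree at most `2j + 1` in `z`, whose coefficients are the
convolutions of the expansions for `h = j` and `h = j + 1`, at `(a, b) = (q, q^2)`. -/
def Dtilde (q : ℂ) (j : ℕ) (z : ℂ) : ℂ :=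
  ∑ n ∈ Finset.range (2 * j + 2),
    (∑ p ∈ Finset.HasAntidiagonal.antidiagonal n,
      denomCoeff (cSeq q (q ^ 2) q) (abSeq q (q ^ 2) q) j p.1 *
        denomCoeff (cSeq q (q ^ 2) q) (abSeq q (q ^ 2) q) (j + 1) p.2) * z ^ n

/-- The coefficient
`q^(j^2) (q; q)_j^4 / ((q; q^2)_j^2 (q^2; q^2)_j^2 (1 - q^(2j+1)))` of the `j`-th series term. -/
def seriesCoeff (q : ℂ) (j : ℕ) : ℂ :=
  q ^ (j ^ 2) * qPoch q q j ^ 4 /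
    (qPoch q (q ^ 2) j ^ 2 * qPoch (q ^ 2) (q ^ 2) j ^ 2 * (1 - q ^ (2 * j + 1)))

/-- The `j`-th term (`j ≥ 1`) with its `i`-th derivative in `z`, multiplied by `z^i`, at `z`, for
the series with terms `seriesCoeff q j * z^(2j+1) / D̃_{0,j}(q, z)`. -/
def termA (q : ℂ) (i j : ℕ) (z : ℂ) : ℂ :=
  seriesCoeff q j * z ^ i * iteratedDeriv i (fun w : ℂ => w ^ (2 * j + 1) / Dtilde q j w) z

/-- The same for the series with terms `q * seriesCoeff q j * z^(2j) / D̃_{0,j}(q, z)`. -/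
def termB (q : ℂ) (i j : ℕ) (z : ℂ) : ℂ :=
  q * seriesCoeff q j * z ^ i * iteratedDeriv i (fun w : ℂ => w ^ (2 * j) / Dtilde q j w) z

/-- The expansion obtained from the generating function `∑ z^n / (1 - q^n)`, `n ≥ 1`. -/
def expansionA (α : ℕ) (q z : ℂ) : ℂ :=
  ∑ i ∈ Finset.range (α + 1), (Nat.stirlingSecond α i : ℂ) *
    (z ^ i * iteratedDeriv i (fun w : ℂ => w * (1 + q) / ((1 - q) * (1 + q - w))) z +
      ∑' j : ℕ, termA q i (j + 1) z)

/-- The expansion obtained from the generating function `∑ q z^n / (1 - q^(n+1))`, `n ≥ 0`. -/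
def expansionB (α : ℕ) (q z : ℂ) : ℂ :=
  ∑ i ∈ Finset.range (α + 1), (Nat.stirlingSecond (α + 1) (i + 1) : ℂ) *
    (z ^ i * (i.factorial : ℂ) * (q * (1 + q)) / ((1 - q) * (1 + q - z) ^ (i + 1)) +
      ∑' j : ℕ, termB q i (j + 1) z)

end JFrac

end

/-!
The J-fraction is that of the little `q`-Legendre polynomials, and the proof rests on an explicit
second solution of its three-term recurrence.

At `(a, b) = (q, q²)` the parameters simplify (`cSeq_succ`, `abSeq_add_two`). The `h`-th monic
orthogonal polynomial `p_h` of the functional `L(x^n) = (1 - q) / (1 - q^(n+1))` has moments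
`L(x^n p_h)` in product form, and the recurrence for these products is a rational identity in `q`,
`q^h` and `q^n` (`moment_add_two`). Their generating functions `R_h` therefore satisfy the
recurrence of the denominators `Q_h`, with `R_0 = F = (1 - q) ∑ z^n / (1 - q^(n+1))` and
`R_1 = Q_1 F - 1` (`remainder_add_two`, `remainder_one`). The Casoratian
`R_h Q_(h+1) - R_(h+1) Q_h` is the product of the coefficients `ab_i z²`, which is
`(1 - q) K_h z^(2h)` (`remainder_mul_convDenom_sub`). Hence
`K_h z^(2h) / (Q_h Q_(h+1)) = (R_h / Q_h - R_(h+1) / Q_(h+1)) / (1 - q)`, and the sum over `h`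
telescopes to `F / (1 - q)`, because `R_h / Q_h` tends to zero (`hasSum_seriesCoeff_mul`).

For `|q|, |z| ≤ 0.21` the norms of the `Q_h` at most halve from one `h` to the next, while the
numerators decay faster. So no `Q_h` vanishes there and the series over `h` is dominated by a
geometric series. As `q` lies inside the disc, termwise differentiation at `z = q` is allowed
(`exists_hasSum_iteratedDeriv`). Expanding `n^α` in falling factorials with Stirling numbers turns
the derivatives into the Lambert series of `n^α`, which generates the divisor sums.

The formula for `D̃_{0,j}` is combinatorial. The continuant `Q_h` is the sum, over all sets of
disjoint pairs `{k - 1, k}` in `{1, …, h}`, of products of `-ab_k z²` over the pairs and of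
`1 - c_i z` over the remaining `i`. Dividing by `(1 - c_1 z) ⋯ (1 - c_h z)` gives the nested sums
(`coe_convDenomPoly`).
-/

namespace JFrac

/-! ### Convergent denominators as polynomials -/

/-- The convergent denominator `Q_h` as a polynomial in `z`. -/
noncomputable def convDenomPoly (c ab : ℕ → ℂ) : ℕ → Polynomial ℂ
  | 0 => 1
  | 1 => 1 - Polynomial.C (c 1) * Polynomial.X
  | h + 2 => (1 - Polynomial.C (c (h + 2)) * Polynomial.X) * convDenomPoly c ab (h + 1) -
      Polynomial.C (ab (h + 2)) * Polynomial.X ^ 2 * convDenomPoly c ab h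

lemma eval_convDenomPoly (c ab : ℕ → ℂ) (z : ℂ) (h : ℕ) :
    (convDenomPoly c ab h).eval z = convDenom c ab z h := by
  induction h using Nat.twoStepInduction with
  | zero => simp [convDenomPoly, convDenom]
  | one => simp [convDenomPoly, convDenom]
  | more h h0 h1 => simp [convDenomPoly, convDenom, h0, h1]

lemma natDegree_convDenomPoly_le (c ab : ℕ → ℂ) (h : ℕ) :
    (convDenomPoly c ab h).natDegree ≤ h := by
  have linear (a : ℂ) : (1 - Polynomial.C a * Polynomial.X : Polynomial ℂ).natDegree ≤ 1 := by
    compute_degree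
  induction h using Nat.twoStepInduction with
  | zero => simp [convDenomPoly]
  | one => exact linear _
  | more h h0 h1 =>
    refine (Polynomial.natDegree_sub_le _ _).trans (max_le ?_ ?_)
    · exact Polynomial.natDegree_mul_le.trans (by have := linear (c (h + 2)); omega)
    · refine Polynomial.natDegree_mul_le.trans ?_
      have := Polynomial.natDegree_C_mul_X_pow_le (ab (h + 2)) 2
      omega

/-! ### Sums over index sequences with gaps -/

/-- The sequences `2 ≤ k_1, k_1 + 2 ≤ k_2, …, k_m ≤ h`. They index the sets of `m` disjoint pairs
`{k - 1, k}` of neighbours in `{1, …, h}`. -/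
def gapSeqs (h m : ℕ) : Finset (Fin m → ℕ) :=
  (Fintype.piFinset (fun _ : Fin m => Finset.Icc 2 h)).filter
    (fun k => ∀ i j : Fin m, i < j → k i + 2 ≤ k j)

/-- The sum over `gapSeqs h m` of the products of weights `w k_1 ⋯ w k_m`. -/
def gapSum {R : Type*} [CommRing R] (w : ℕ → R) (h m : ℕ) : R :=
  ∑ k ∈ gapSeqs h m, ∏ i, w (k i)

lemma mem_gapSeqs {h m : ℕ} {k : Fin m → ℕ} :
    k ∈ gapSeqs h m ↔
      (∀ i, 2 ≤ k i ∧ k i ≤ h) ∧ ∀ i j : Fin m, i < j → k i + 2 ≤ k j := by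
  simp [gapSeqs, Fintype.mem_piFinset]

section
variable {R : Type*} [CommRing R] (w : ℕ → R)

lemma gapSum_zero_right (h : ℕ) : gapSum w h 0 = 1 := by
  simp [gapSum, gapSeqs]

lemma gapSum_eq_zero_of_le_one {h : ℕ} (hh : h ≤ 1) (m : ℕ) : gapSum w h (m + 1) = 0 := by
  refine Finset.sum_eq_zero fun k hk => ?_
  have := (mem_gapSeqs.1 hk).1 0
  omega

/-- The largest index `k_{m+1}` either equals `h + 2`, and then the others are at most `h`, or is
at most `h + 1`. -/
lemma gapSum_succ_succ (h m : ℕ) :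
    gapSum w (h + 2) (m + 1) = gapSum w (h + 1) (m + 1) + w (h + 2) * gapSum w h m := by
  have last_max {k : Fin (m + 1) → ℕ} (hk : ∀ i j, i < j → k i + 2 ≤ k j) (i) :
      k i ≤ k (Fin.last m) := by
    rcases (Fin.le_last i).eq_or_lt with rfl | hi
    · rfl
    · have := hk _ _ hi
      omega
  rw [gapSum, ← Finset.sum_filter_not_add_sum_filter _ (fun k => k (Fin.last m) = h + 2)]
  congr 1
  · refine Finset.sum_congr (Finset.ext fun k => ?_) fun _ _ => rfl
    rw [Finset.mem_filter, mem_gapSeqs, mem_gapSeqs]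
    constructor
    · rintro ⟨⟨hk, hg⟩, hl⟩
      refine ⟨fun i => ⟨(hk i).1, ?_⟩, hg⟩
      have := last_max hg i
      have := (hk (Fin.last m)).2
      omega
    · rintro ⟨hk, hg⟩
      refine ⟨⟨fun i => ⟨(hk i).1, ?_⟩, hg⟩, ?_⟩
      · have := (hk i).2
        omega
      · have := (hk (Fin.last m)).2
        omega
  · rw [gapSum, Finset.mul_sum]
    refine Finset.sum_bij' (fun k _ => Fin.init k)
      (fun k _ => (Fin.snoc k (h + 2) : Fin (m + 1) → ℕ)) ?_ ?_ ?_ ?_ ?_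
    · intro k hk
      rw [Finset.mem_filter, mem_gapSeqs] at hk
      obtain ⟨⟨hk, hg⟩, hl⟩ := hk
      refine mem_gapSeqs.2 ⟨fun i => ⟨(hk _).1, ?_⟩, fun i j hij => hg _ _ (by simpa using hij)⟩
      have := hg i.castSucc (Fin.last m) (Fin.castSucc_lt_last i)
      simp only [Fin.init]
      omega
    · intro k hk
      rw [mem_gapSeqs] at hk
      obtain ⟨hk, hg⟩ := hk
      rw [Finset.mem_filter, mem_gapSeqs]
      refine ⟨⟨fun i => ?_, fun i j hij => ?_⟩, by simp⟩
      · refine Fin.lastCases ?_ (fun i => ?_) i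
        · simp
        · have := hk i
          simp only [Fin.snoc_castSucc]
          omega
      · revert hij
        refine Fin.lastCases (fun hij => ?_) (fun i => ?_) i
        · exact absurd hij (not_lt.2 (Fin.le_last j))
        · refine Fin.lastCases (fun _ => ?_) (fun j hij => ?_) j
          · have := hk i
            simp only [Fin.snoc_castSucc, Fin.snoc_last]
            omega
          · simpa using hg i j (by simpa using hij)
    · intro k hk
      rw [← (Finset.mem_filter.1 hk).2]
      exact Fin.snoc_init_self k
    · intro k _
      simp
    · intro k hk
      rw [Fin.prod_univ_castSucc, (Finset.mem_filter.1 hk).2, mul_comm]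
      rfl

/-- At most `h / 2` disjoint pairs of neighbours fit into `{1, …, h}`. -/
lemma gapSum_eq_zero {h m : ℕ} (hm : h / 2 < m) : gapSum w h m = 0 := by
  induction h using Nat.twoStepInduction generalizing m with
  | zero =>
    obtain ⟨m, rfl⟩ := Nat.exists_eq_succ_of_ne_zero (by omega : m ≠ 0)
    exact gapSum_eq_zero_of_le_one w (by omega) m
  | one =>
    obtain ⟨m, rfl⟩ := Nat.exists_eq_succ_of_ne_zero (by omega : m ≠ 0)
    exact gapSum_eq_zero_of_le_one w (by omega) m
  | more h h0 h1 =>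
    obtain ⟨m, rfl⟩ := Nat.exists_eq_succ_of_ne_zero (by omega : m ≠ 0)
    rw [Nat.succ_eq_add_one, gapSum_succ_succ, h0 (by omega), h1 (by omega), mul_zero, add_zero]

/-- The generating function of the sums `gapSum w h m` over `m` satisfies the three-term recurrence
of a continuant. -/
lemma sum_pow_mul_gapSum_add_two (x : R) (h : ℕ) :
    ∑ m ∈ Finset.range ((h + 2) / 2 + 1), x ^ m * gapSum w (h + 2) m =
      ∑ m ∈ Finset.range ((h + 1) / 2 + 1), x ^ m * gapSum w (h + 1) m +
        x * w (h + 2) * ∑ m ∈ Finset.range (h / 2 + 1), x ^ m * gapSum w h m := by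
  have extend : ∑ m ∈ Finset.range ((h + 1) / 2 + 1), x ^ m * gapSum w (h + 1) m =
      ∑ m ∈ Finset.range (h / 2 + 1 + 1), x ^ m * gapSum w (h + 1) m := by
    refine Finset.sum_subset (Finset.range_mono (by omega)) fun m _ hm => ?_
    rw [Finset.mem_range] at hm
    rw [gapSum_eq_zero w (by omega), mul_zero]
  rw [extend, show (h + 2) / 2 + 1 = h / 2 + 1 + 1 by omega, Finset.sum_range_succ',
    Finset.sum_range_succ' _ (h / 2 + 1)]
  simp only [gapSum_succ_succ, gapSum_zero_right, mul_add, Finset.sum_add_distrib, Finset.mul_sum]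
  rw [add_right_comm]
  congr 1
  exact Finset.sum_congr rfl fun m _ => by ring

end

/-! ### The coefficients of the convergent denominators -/

/-- The power series `ab_k / ((1 - c_k X)(1 - c_{k-1} X))`. -/
noncomputable def pairWeight (c ab : ℕ → ℂ) (k : ℕ) : PowerSeries ℂ :=
  PowerSeries.C (ab k) * (1 - PowerSeries.C (c k) * PowerSeries.X)⁻¹ *
    (1 - PowerSeries.C (c (k - 1)) * PowerSeries.X)⁻¹

/-- The product `(1 - c_1 X) ⋯ (1 - c_h X)`. -/
noncomputable def linearProd (c : ℕ → ℂ) (h : ℕ) : PowerSeries ℂ :=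
  ∏ i ∈ Finset.range h, (1 - PowerSeries.C (c (i + 1)) * PowerSeries.X)

lemma coeff_linearProd (c : ℕ → ℂ) (h n : ℕ) :
    PowerSeries.coeff n (linearProd c h) = stirlingQ c h n := by
  induction h generalizing n with
  | zero => cases n <;> simp [linearProd, stirlingQ, PowerSeries.coeff_one]
  | succ h ih =>
    rw [linearProd, Finset.prod_range_succ, ← linearProd, mul_sub, mul_one, mul_left_comm,
      map_sub, PowerSeries.coeff_C_mul, ih]
    cases n with
    | zero => simp [stirlingQ]
    | succ n => rw [PowerSeries.coeff_succ_mul_X, ih, stirlingQ]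

lemma sum_nestedSum (c ab : ℕ → ℂ) (h m : ℕ) :
    ∑ s ∈ Finset.range (m * h + 1), nestedSum c ab h m s = gapSum (pairWeight c ab) h m := by
  have maps : ∀ k ∈ gapSeqs h m, ∑ i, k i ∈ Finset.range (m * h + 1) := fun k hk => by
    have := Finset.sum_le_card_nsmul Finset.univ k h fun i _ => ((mem_gapSeqs.1 hk).1 i).2
    simp only [Finset.card_univ, Fintype.card_fin, smul_eq_mul] at this
    exact Finset.mem_range.2 (Nat.lt_succ_of_le this)
  rw [gapSum, ← Finset.sum_fiberwise_of_maps_to maps]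
  refine Finset.sum_congr rfl fun s _ => ?_
  rw [gapSeqs, Finset.filter_filter]
  rfl

/-- Each of the disjoint pairs `{k - 1, k}` replaces a factor `(1 - c_{k-1} z)(1 - c_k z)` of
`(1 - c_1 z) ⋯ (1 - c_h z)` by `-ab_k z²`. -/
lemma coe_convDenomPoly (c ab : ℕ → ℂ) (h : ℕ) :
    (convDenomPoly c ab h : PowerSeries ℂ) =
      linearProd c h *
        ∑ m ∈ Finset.range (h / 2 + 1),
          (-PowerSeries.X ^ 2) ^ m * gapSum (pairWeight c ab) h m := by
  induction h using Nat.twoStepInduction with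
  | zero => simp [convDenomPoly, linearProd, gapSum_zero_right]
  | one => simp [convDenomPoly, linearProd, gapSum_zero_right]
  | more h h0 h1 =>
    have unit (a : ℂ) : (1 - PowerSeries.C a * PowerSeries.X : PowerSeries ℂ) *
        (1 - PowerSeries.C a * PowerSeries.X)⁻¹ = 1 :=
      PowerSeries.mul_inv_cancel _ (by simp)
    have step (i : ℕ) : linearProd c (i + 1) =
        linearProd c i * (1 - PowerSeries.C (c (i + 1)) * PowerSeries.X) :=
      Finset.prod_range_succ _ _
    have cancel : linearProd c (h + 2) * pairWeight c ab (h + 2) =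
        linearProd c h * PowerSeries.C (ab (h + 2)) := by
      rw [step, step, pairWeight, show h + 2 - 1 = h + 1 from rfl]
      linear_combination
        linearProd c h * PowerSeries.C (ab (h + 2)) * ((1 - PowerSeries.C (c (h + 1)) *
          PowerSeries.X) * (1 - PowerSeries.C (c (h + 1)) * PowerSeries.X)⁻¹ *
            unit (c (h + 2)) + unit (c (h + 1)))
    rw [sum_pow_mul_gapSum_add_two, convDenomPoly]
    push_cast
    rw [h0, h1]
    linear_combination
      -(∑ m ∈ Finset.range ((h + 1) / 2 + 1),
          (-PowerSeries.X ^ 2) ^ m * gapSum (pairWeight c ab) (h + 1) m) * step (h + 1) +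
        (PowerSeries.X ^ 2 * ∑ m ∈ Finset.range (h / 2 + 1),
          (-PowerSeries.X ^ 2) ^ m * gapSum (pairWeight c ab) h m) * cancel

lemma denomCoeff_eq_coeff (c ab : ℕ → ℂ) (h n : ℕ) :
    denomCoeff c ab h n = (convDenomPoly c ab h).coeff n := by
  rw [← Polynomial.coeff_coe, coe_convDenomPoly, Finset.sum_range_succ', gapSum_zero_right,
    pow_zero, one_mul, mul_add, mul_one, map_add, coeff_linearProd, add_comm, denomCoeff]
  congr 1
  rw [Finset.mul_sum, map_sum, ← Nat.Ico_zero_eq_range (h / 2),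
    Finset.sum_Ico_add' (fun m => PowerSeries.coeff n (linearProd c h *
      ((-PowerSeries.X ^ 2) ^ m * gapSum (pairWeight c ab) h m))) 0 (h / 2) 1]
  refine Finset.sum_congr (by ext; simp) fun m _ => ?_
  rw [← sum_nestedSum, Finset.mul_sum, Finset.mul_sum, map_sum]
  refine Finset.sum_congr rfl fun s _ => ?_
  rw [mul_comm (linearProd c h), PowerSeries.coeff_mul,
    Finset.Nat.sum_antidiagonal_eq_sum_range_succ_mk]
  refine Finset.sum_congr rfl fun k _ => ?_
  rw [coeff_linearProd, show (-PowerSeries.X ^ 2 : PowerSeries ℂ) ^ m =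
    PowerSeries.C ((-1) ^ m) * PowerSeries.X ^ (2 * m) by
      rw [neg_pow, pow_mul, map_pow, map_neg, map_one], mul_assoc (PowerSeries.C _),
    PowerSeries.coeff_C_mul, PowerSeries.coeff_X_pow_mul']
  ring

lemma Dtilde_eq_mul (q : ℂ) (j : ℕ) (z : ℂ) :
    Dtilde q j z =
      convDenom (cSeq q (q ^ 2) q) (abSeq q (q ^ 2) q) z j *
        convDenom (cSeq q (q ^ 2) q) (abSeq q (q ^ 2) q) z (j + 1) := by
  have deg : (convDenomPoly (cSeq q (q ^ 2) q) (abSeq q (q ^ 2) q) j *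
      convDenomPoly (cSeq q (q ^ 2) q) (abSeq q (q ^ 2) q) (j + 1)).natDegree < 2 * j + 2 := by
    refine Polynomial.natDegree_mul_le.trans_lt ?_
    have h0 := natDegree_convDenomPoly_le (cSeq q (q ^ 2) q) (abSeq q (q ^ 2) q) j
    have h1 := natDegree_convDenomPoly_le (cSeq q (q ^ 2) q) (abSeq q (q ^ 2) q) (j + 1)
    omega
  rw [← eval_convDenomPoly, ← eval_convDenomPoly, ← Polynomial.eval_mul,
    Polynomial.eval_eq_sum_range' deg]
  simp only [Dtilde, denomCoeff_eq_coeff, Polynomial.coeff_mul]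

/-! ### The J-fraction parameters at `(a, b) = (q, q²)` -/

lemma one_sub_pow_ne_zero {q : ℂ} (hq : ‖q‖ < 1) {k : ℕ} (hk : k ≠ 0) : 1 - q ^ k ≠ 0 := by
  intro h
  have := pow_lt_one₀ (norm_nonneg q) hq hk
  rw [← norm_pow, ← sub_eq_zero.1 h, norm_one] at this
  exact lt_irrefl _ this

lemma one_add_pow_ne_zero {q : ℂ} (hq : ‖q‖ < 1) {k : ℕ} (hk : k ≠ 0) : 1 + q ^ k ≠ 0 := by
  intro h
  have := pow_lt_one₀ (norm_nonneg q) hq hk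
  rw [← norm_pow, eq_neg_of_add_eq_zero_right h, norm_neg, norm_one] at this
  exact lt_irrefl _ this

lemma cSeq_succ {q : ℂ} (hq : ‖q‖ < 1) (i : ℕ) :
    cSeq q (q ^ 2) q (i + 1) = 2 * q ^ i / ((1 + q ^ i) * (1 + q ^ (i + 1))) := by
  have s1 := one_sub_pow_ne_zero hq one_ne_zero
  have a1 := one_add_pow_ne_zero hq one_ne_zero
  simp only [pow_one] at s1 a1
  rcases i with _ | i
  · have s2 : q ^ 2 - 1 ≠ 0 := by
      rw [show q ^ 2 - 1 = -((1 - q) * (1 + q)) by ring]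
      exact neg_ne_zero.2 (mul_ne_zero s1 a1)
    rw [cSeq, if_neg (by norm_num), if_pos rfl]
    simp only [zero_add, pow_zero, pow_one, mul_one]
    rw [div_eq_div_iff s2 (mul_ne_zero (by norm_num) a1)]
    ring
  · have e1 : q ^ (((i + 1 + 1 : ℕ) : ℤ) - 2) = q ^ i := by
      rw [← zpow_natCast]; congr 1; push_cast; ring
    have e2 : q ^ (2 * ((i + 1 + 1 : ℕ) : ℤ) - 3) = q ^ (2 * i + 1) := by
      rw [← zpow_natCast]; congr 1; push_cast; ring
    have e3 : q ^ (((i + 1 + 1 : ℕ) : ℤ) - 1) = q ^ (i + 1) := by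
      rw [← zpow_natCast]; congr 1; push_cast; ring
    have e4 : q ^ (2 * ((i + 1 + 1 : ℕ) : ℤ) - 4) = q ^ (2 * i) := by
      rw [← zpow_natCast]; congr 1; push_cast; ring
    have e5 : q ^ (2 * ((i + 1 + 1 : ℕ) : ℤ) - 2) = q ^ (2 * i + 2) := by
      rw [← zpow_natCast]; congr 1; push_cast; ring
    rw [cSeq, if_pos (by omega), e1, e2, e3, e4, e5, zpow_natCast]
    have h1 := one_sub_pow_ne_zero hq i.succ_ne_zero
    have h2 := one_add_pow_ne_zero hq i.succ_ne_zero
    have h3 := one_sub_pow_ne_zero hq (i + 1).succ_ne_zero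
    have h4 := one_add_pow_ne_zero hq (i + 1).succ_ne_zero
    simp only [Nat.succ_eq_add_one] at h1 h2 h3 h4
    have d1 : 1 - q ^ 2 * q ^ (2 * i) = (1 - q ^ (i + 1)) * (1 + q ^ (i + 1)) := by ring
    have d2 : 1 - q ^ 2 * q ^ (2 * i + 2) = (1 - q ^ (i + 1 + 1)) * (1 + q ^ (i + 1 + 1)) := by ring
    rw [d1, d2, div_eq_div_iff (by positivity) (by positivity)]
    ring

lemma abSeq_add_two {q : ℂ} (hq0 : q ≠ 0) (hq : ‖q‖ < 1) (i : ℕ) :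
    abSeq q (q ^ 2) q (i + 2) = q ^ (2 * i + 1) * (1 - q ^ (i + 1)) ^ 2 /
      ((1 + q ^ (i + 1)) ^ 2 * (1 - q ^ (2 * i + 1)) * (1 - q ^ (2 * i + 3))) := by
  have e1 : q ^ (2 * ((i + 2 : ℕ) : ℤ) - 4) = q ^ (2 * i) := by
    rw [← zpow_natCast]; congr 1; push_cast; ring
  have e2 : q ^ 2 * q ^ (((i + 2 : ℕ) : ℤ) - 3) = q ^ (i + 1) := by
    rw [← zpow_natCast, ← zpow_natCast, ← zpow_add₀ hq0]; congr 1; push_cast; ring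
  have e3 : q ^ (((i + 2 : ℕ) : ℤ) - 2) = q ^ i := by
    rw [← zpow_natCast]; congr 1; push_cast; ring
  have e4 : q ^ (((i + 2 : ℕ) : ℤ) - 1) = q ^ (i + 1) := by
    rw [← zpow_natCast]; congr 1; push_cast; ring
  have e5 : q ^ 2 * q ^ (2 * ((i + 2 : ℕ) : ℤ) - 5) = q ^ (2 * i + 1) := by
    rw [← zpow_natCast, ← zpow_natCast, ← zpow_add₀ hq0]; congr 1; push_cast; ring
  have e6 : q ^ (2 * ((i + 2 : ℕ) : ℤ) - 3) = q ^ (2 * i + 1) := by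
    rw [← zpow_natCast]; congr 1; push_cast; ring
  rw [abSeq, e1, e2, e3, e4, e5, e6]
  have h1 := one_sub_pow_ne_zero hq i.succ_ne_zero
  have h2 := one_add_pow_ne_zero hq i.succ_ne_zero
  have h3 := one_sub_pow_ne_zero hq (2 * i).succ_ne_zero
  have h4 := one_sub_pow_ne_zero hq (2 * i + 2).succ_ne_zero
  simp only [Nat.succ_eq_add_one] at h1 h2 h3 h4
  have d1 : 1 - q ^ 2 * q ^ (2 * i) = (1 - q ^ (i + 1)) * (1 + q ^ (i + 1)) := by ring
  have d2 : 1 - q ^ 2 * q ^ (2 * i + 1) = 1 - q ^ (2 * i + 2 + 1) := by ring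
  rw [d1, d2, div_eq_div_iff (by positivity) (by positivity)]
  ring

lemma seriesCoeff_zero (q : ℂ) : seriesCoeff q 0 = 1 / (1 - q) := by
  simp [seriesCoeff, qPoch]

lemma seriesCoeff_succ {q : ℂ} (hq0 : q ≠ 0) (hq : ‖q‖ < 1) (j : ℕ) :
    seriesCoeff q (j + 1) = abSeq q (q ^ 2) q (j + 2) * seriesCoeff q j := by
  have h1 := one_sub_pow_ne_zero hq j.succ_ne_zero
  have h2 := one_add_pow_ne_zero hq j.succ_ne_zero
  have h3 := one_sub_pow_ne_zero hq (2 * j).succ_ne_zero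
  have h4 := one_sub_pow_ne_zero hq (2 * j + 2).succ_ne_zero
  simp only [Nat.succ_eq_add_one] at h1 h2 h3 h4
  have hA : qPoch q (q ^ 2) j ≠ 0 := by
    refine Finset.prod_ne_zero_iff.2 fun k _ => ?_
    rw [show q * (q ^ 2) ^ k = q ^ (2 * k + 1) by ring]
    exact one_sub_pow_ne_zero hq (by omega)
  have hB : qPoch (q ^ 2) (q ^ 2) j ≠ 0 := by
    refine Finset.prod_ne_zero_iff.2 fun k _ => ?_
    rw [show q ^ 2 * (q ^ 2) ^ k = q ^ (2 * k + 2) by ring]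
    exact one_sub_pow_ne_zero hq (by omega)
  have s1 : qPoch q q (j + 1) = qPoch q q j * (1 - q ^ (j + 1)) := by
    rw [qPoch, Finset.prod_range_succ, ← qPoch]; ring
  have s2 : qPoch q (q ^ 2) (j + 1) = qPoch q (q ^ 2) j * (1 - q ^ (2 * j + 1)) := by
    rw [qPoch, Finset.prod_range_succ, ← qPoch]; ring
  have s3 : qPoch (q ^ 2) (q ^ 2) (j + 1) =
      qPoch (q ^ 2) (q ^ 2) j * ((1 - q ^ (j + 1)) * (1 + q ^ (j + 1))) := by
    rw [qPoch, Finset.prod_range_succ, ← qPoch]; ring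
  rw [abSeq_add_two hq0 hq, seriesCoeff, seriesCoeff, s1, s2, s3,
    show 2 * (j + 1) + 1 = 2 * j + 2 + 1 by ring, show 2 * j + 3 = 2 * j + 2 + 1 by ring,
    show q ^ ((j + 1) ^ 2) = q ^ (j ^ 2) * q ^ (2 * j + 1) by ring]
  rw [div_mul_div_comm, div_eq_div_iff (by positivity) (by positivity)]
  ring

/-! ### The second solution of the recurrence -/

/-- The normalising factor of `moment q h n`. -/
noncomputable def momentCoeff (q : ℂ) (h : ℕ) : ℂ :=
  (1 - q) * ∏ k ∈ Finset.range h,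
    (q ^ (k + 1) * (1 - q ^ (k + 1)) / ((1 - q ^ (2 * k + 1)) * (1 + q ^ (k + 1))))

/-- The moment `L(x^n p_h(x))`, where `L` is the functional `L(x^n) = (1 - q) / (1 - q^(n+1))` and
`p_h` is the `h`-th monic orthogonal polynomial of `L` (a little `q`-Legendre polynomial), in the
product form that the Rodrigues formula gives. -/
noncomputable def moment (q : ℂ) (h n : ℕ) : ℂ :=
  momentCoeff q h * (∏ k ∈ Finset.range h, (q ^ k - q ^ n)) /
    ∏ k ∈ Finset.range (h + 1), (1 - q ^ (n + 1 + k))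

lemma moment_zero_left (q : ℂ) (n : ℕ) : moment q 0 n = (1 - q) / (1 - q ^ (n + 1)) := by
  simp [moment, momentCoeff]

lemma moment_succ_zero (q : ℂ) (h : ℕ) : moment q (h + 1) 0 = 0 := by
  simp [moment, Finset.prod_range_succ']

lemma momentCoeff_succ (q : ℂ) (h : ℕ) : momentCoeff q (h + 1) = momentCoeff q h *
    (q ^ (h + 1) * (1 - q ^ (h + 1)) / ((1 - q ^ (2 * h + 1)) * (1 + q ^ (h + 1)))) := by
  rw [momentCoeff, Finset.prod_range_succ, ← mul_assoc, ← momentCoeff]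

lemma moment_succ_left (q : ℂ) (h n : ℕ) :
    moment q (h + 1) n = moment q h n *
      (q ^ (h + 1) * (1 - q ^ (h + 1)) / ((1 - q ^ (2 * h + 1)) * (1 + q ^ (h + 1))) *
        ((q ^ h - q ^ n) / (1 - q ^ (n + h + 2)))) := by
  rw [moment, momentCoeff_succ, Finset.prod_range_succ, Finset.prod_range_succ _ (h + 1), moment,
    show n + 1 + (h + 1) = n + h + 2 by ring]
  simp only [div_eq_mul_inv, mul_inv]
  ring

lemma moment_succ_right {q : ℂ} (hq : ‖q‖ < 1) (h n : ℕ) :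
    moment q (h + 1) (n + 1) = moment q h n *
      (q ^ (h + 1) * (1 - q ^ (h + 1)) / ((1 - q ^ (2 * h + 1)) * (1 + q ^ (h + 1))) *
        (q ^ h * (1 - q ^ (n + 1)) ^ 2 / ((1 - q ^ (n + h + 2)) * (1 - q ^ (n + h + 3))))) := by
  have hn := one_sub_pow_ne_zero hq n.succ_ne_zero
  have num : ∏ k ∈ Finset.range (h + 1), (q ^ k - q ^ (n + 1)) =
      (1 - q ^ (n + 1)) * (q ^ h * ∏ k ∈ Finset.range h, (q ^ k - q ^ n)) := by
    rw [Finset.prod_range_succ', pow_zero, mul_comm]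
    congr 1
    conv_rhs => rw [← Finset.card_range h, ← Finset.prod_const, Finset.card_range,
      ← Finset.prod_mul_distrib]
    exact Finset.prod_congr rfl fun k _ => by ring
  have den : ∏ k ∈ Finset.range (h + 1 + 1), (1 - q ^ (n + 1 + 1 + k)) =
      (1 - q ^ (n + 1))⁻¹ * ((∏ k ∈ Finset.range (h + 1), (1 - q ^ (n + 1 + k))) *
        ((1 - q ^ (n + h + 2)) * (1 - q ^ (n + h + 3)))) := by
    rw [eq_inv_mul_iff_mul_eq₀ hn]
    have := Finset.prod_range_succ' (fun k => 1 - q ^ (n + 1 + k)) (h + 1 + 1)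
    rw [Finset.prod_range_succ, Finset.prod_range_succ, add_zero] at this
    rw [show n + h + 2 = n + 1 + (h + 1) by ring, show n + h + 3 = n + 1 + (h + 1 + 1) by ring,
      ← mul_assoc (∏ k ∈ Finset.range (h + 1), (1 - q ^ (n + 1 + k))), this, mul_comm]
    congr 1
    exact Finset.prod_congr rfl fun k _ => by rw [show n + 1 + (k + 1) = n + 1 + 1 + k by ring]
  rw [moment, momentCoeff_succ, num, den, moment]
  simp only [div_eq_mul_inv, mul_inv, inv_inv]
  ring

/-- The orthogonal polynomials satisfy `p_{h+2} = (x - c_{h+2}) p_{h+1} - ab_{h+2} p_h`. -/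
lemma moment_add_two {q : ℂ} (hq0 : q ≠ 0) (hq : ‖q‖ < 1) (h n : ℕ) :
    moment q (h + 2) n = moment q (h + 1) (n + 1) - cSeq q (q ^ 2) q (h + 2) * moment q (h + 1) n -
      abSeq q (q ^ 2) q (h + 2) * moment q h n := by
  have s1 := one_sub_pow_ne_zero hq (k := h + 1) (by omega)
  have a1 := one_add_pow_ne_zero hq (k := h + 1) (by omega)
  have a2 := one_add_pow_ne_zero hq (k := h + 2) (by omega)
  have s3 := one_sub_pow_ne_zero hq (k := 2 * h + 1) (by omega)
  have s4 := one_sub_pow_ne_zero hq (k := 2 * h + 3) (by omega)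
  have s5 := one_sub_pow_ne_zero hq (k := n + h + 2) (by omega)
  have s6 := one_sub_pow_ne_zero hq (k := n + h + 3) (by omega)
  rw [moment_succ_left q (h + 1), moment_succ_left q h, moment_succ_right hq, abSeq_add_two hq0 hq,
    cSeq_succ hq, mul_assoc, ← sub_eq_zero]
  simp only [show h + 1 + 1 = h + 2 by ring, show 2 * (h + 1) + 1 = 2 * h + 3 by ring,
    show n + (h + 1) + 2 = n + h + 3 by ring]
  -- Every moment is a multiple of `moment q h n`; what remains is rational in `q`, `q^h`, `q^n`.
  generalize moment q h n = M
  have p1 : q ^ (h + 1) = q * q ^ h := by ring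
  have p2 : q ^ (h + 2) = q ^ 2 * q ^ h := by ring
  have p3 : q ^ (2 * h + 1) = q * (q ^ h) ^ 2 := by ring
  have p4 : q ^ (2 * h + 3) = q ^ 3 * (q ^ h) ^ 2 := by ring
  have p5 : q ^ (n + h + 2) = q ^ 2 * q ^ h * q ^ n := by ring
  have p6 : q ^ (n + h + 3) = q ^ 3 * q ^ h * q ^ n := by ring
  have p7 : q ^ (n + 1) = q * q ^ n := by ring
  rw [p1] at s1 a1
  rw [p2] at a2
  rw [p3] at s3
  rw [p4] at s4
  rw [p5] at s5
  rw [p6] at s6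
  rw [p1, p2, p3, p4, p5, p6, p7]
  generalize q ^ h = y at *
  generalize q ^ n = x at *
  field_simp
  ring

lemma moment_one {q : ℂ} (hq : ‖q‖ < 1) (n : ℕ) :
    moment q 1 n = moment q 0 (n + 1) - cSeq q (q ^ 2) q 1 * moment q 0 n := by
  have s0 := one_sub_pow_ne_zero hq one_ne_zero
  have a0 := one_add_pow_ne_zero hq one_ne_zero
  have s1 := one_sub_pow_ne_zero hq (k := n + 1) (by omega)
  have s2 := one_sub_pow_ne_zero hq (k := n + 2) (by omega)
  rw [moment_succ_left q 0, moment_zero_left, moment_zero_left, cSeq_succ hq]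
  have p1 : q ^ (n + 1) = q * q ^ n := by ring
  have p2 : q ^ (n + 2) = q ^ 2 * q ^ n := by ring
  simp only [mul_zero, add_zero, zero_add, pow_zero, pow_one, show n + 1 + 1 = n + 2 by ring]
    at s0 a0 s1 s2 ⊢
  rw [p1] at s1
  rw [p2] at s2
  rw [p1, p2]
  generalize q ^ n = x at *
  have two : (1 + 1 : ℂ) ≠ 0 := by norm_num
  field_simp
  ring

/-! ### Estimates on the disc of radius `0.21` -/

lemma norm_pow_le_of_norm_le {q : ℂ} (hq : ‖q‖ ≤ 0.21) {k : ℕ} (hk : k ≠ 0) :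
    ‖q ^ k‖ ≤ 0.21 := by
  rw [norm_pow]
  exact (pow_le_of_le_one (norm_nonneg q) (by linarith) hk).trans hq

lemma le_norm_one_sub {w : ℂ} (hw : ‖w‖ ≤ 0.21) : 0.79 ≤ ‖1 - w‖ := by
  have := norm_sub_norm_le 1 w
  rw [norm_one] at this
  linarith

lemma norm_one_sub_le {w : ℂ} (hw : ‖w‖ ≤ 0.21) : ‖1 - w‖ ≤ 1.21 := by
  have := norm_sub_le 1 w
  rw [norm_one] at this
  linarith

lemma le_norm_one_add {w : ℂ} (hw : ‖w‖ ≤ 0.21) : 0.79 ≤ ‖1 + w‖ := by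
  simpa using le_norm_one_sub (w := -w) (by simpa using hw)

lemma norm_cSeq_succ_le {q : ℂ} (hq : ‖q‖ ≤ 0.21) (h : ℕ) :
    ‖cSeq q (q ^ 2) q (h + 1)‖ ≤ 3 / 2 := by
  have a2 := le_norm_one_add (norm_pow_le_of_norm_le hq h.succ_ne_zero)
  rw [cSeq_succ (by linarith), norm_div, norm_mul, norm_mul, Complex.norm_ofNat]
  rcases eq_or_ne h 0 with rfl | hh
  · simp only [pow_zero, zero_add, Nat.succ_eq_add_one, Complex.norm_ofNat, norm_one,
      show (1 + 1 : ℂ) = 2 by norm_num] at a2 ⊢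
    rw [div_le_iff₀ (by linarith)]
    linarith
  · have n1 := norm_pow_le_of_norm_le hq hh
    have a1 := le_norm_one_add n1
    have := mul_le_mul a1 a2 (by norm_num) (norm_nonneg _)
    rw [div_le_iff₀ (by linarith)]
    linarith

lemma norm_abSeq_add_two_le {q : ℂ} (hq0 : q ≠ 0) (hq : ‖q‖ ≤ 0.21) (h : ℕ) :
    ‖abSeq q (q ^ 2) q (h + 2)‖ ≤ 1 := by
  have n1 := norm_pow_le_of_norm_le hq (k := h + 1) (by omega)
  have n2 := norm_pow_le_of_norm_le hq (k := 2 * h + 1) (by omega)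
  have n3 := norm_pow_le_of_norm_le hq (k := 2 * h + 3) (by omega)
  have a1 := le_norm_one_add n1
  have a2 := le_norm_one_sub n2
  have a3 := le_norm_one_sub n3
  have u1 := norm_one_sub_le n1
  rw [abSeq_add_two hq0 (by linarith), norm_div, norm_mul, norm_mul, norm_mul,
    norm_pow (1 - _), norm_pow (1 + _)]
  refine div_le_one_of_le₀ ?_ (by positivity)
  calc ‖q ^ (2 * h + 1)‖ * ‖1 - q ^ (h + 1)‖ ^ 2 ≤ 0.21 * 1.21 ^ 2 := by gcongr
    _ ≤ 0.79 ^ 2 * 0.79 * 0.79 := by norm_num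
    _ ≤ _ := by gcongr

/-- Each convergent denominator has at least half the norm of the previous one. -/
lemma norm_convDenom_le_two_mul {q z : ℂ} (hq0 : q ≠ 0) (hq : ‖q‖ ≤ 0.21) (hz : ‖z‖ ≤ 0.21)
    (h : ℕ) :
    ‖convDenom (cSeq q (q ^ 2) q) (abSeq q (q ^ 2) q) z h‖ ≤
      2 * ‖convDenom (cSeq q (q ^ 2) q) (abSeq q (q ^ 2) q) z (h + 1)‖ := by
  -- `0.685 = 1 - 3 / 2 * 0.21`
  have lin (i : ℕ) : 0.685 ≤ ‖1 - cSeq q (q ^ 2) q (i + 1) * z‖ := by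
    have h1 := norm_sub_norm_le 1 (cSeq q (q ^ 2) q (i + 1) * z)
    have h2 := mul_le_mul (norm_cSeq_succ_le hq i) hz (norm_nonneg _) (by norm_num)
    rw [norm_one, norm_mul] at h1
    linarith
  induction h with
  | zero =>
    have := lin 0
    simp only [convDenom, norm_one, zero_add] at *
    linarith
  | succ h ih =>
    have quad : ‖abSeq q (q ^ 2) q (h + 2) * z ^ 2‖ ≤ 0.0441 := by
      rw [norm_mul, norm_pow]
      calc _ ≤ (1 : ℝ) * 0.21 ^ 2 := by
            gcongr
            exact norm_abSeq_add_two_le hq0 hq h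
        _ = 0.0441 := by norm_num
    rw [convDenom]
    generalize convDenom (cSeq q (q ^ 2) q) (abSeq q (q ^ 2) q) z h = Q at *
    generalize convDenom (cSeq q (q ^ 2) q) (abSeq q (q ^ 2) q) z (h + 1) = Q' at *
    have h1 := norm_sub_norm_le ((1 - cSeq q (q ^ 2) q (h + 2) * z) * Q')
      (abSeq q (q ^ 2) q (h + 2) * z ^ 2 * Q)
    rw [norm_mul, norm_mul (abSeq q (q ^ 2) q (h + 2) * z ^ 2)] at h1
    have h2 := mul_le_mul_of_nonneg_right (lin (h + 1)) (norm_nonneg Q')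
    have h3 := mul_le_mul quad ih (norm_nonneg _) (by norm_num)
    have h4 := norm_nonneg Q'
    rw [show h + 1 + 1 = h + 2 by ring] at h2
    linarith

lemma half_pow_le_norm_convDenom {q z : ℂ} (hq0 : q ≠ 0) (hq : ‖q‖ ≤ 0.21) (hz : ‖z‖ ≤ 0.21)
    (h : ℕ) : (1 / 2) ^ h ≤ ‖convDenom (cSeq q (q ^ 2) q) (abSeq q (q ^ 2) q) z h‖ := by
  induction h with
  | zero => simp [convDenom]
  | succ h ih =>
    have := norm_convDenom_le_two_mul hq0 hq hz h
    rw [pow_succ]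
    linarith

lemma convDenom_ne_zero {q z : ℂ} (hq0 : q ≠ 0) (hq : ‖q‖ ≤ 0.21) (hz : ‖z‖ ≤ 0.21) (h : ℕ) :
    convDenom (cSeq q (q ^ 2) q) (abSeq q (q ^ 2) q) z h ≠ 0 :=
  norm_pos_iff.1 ((by positivity : (0 : ℝ) < (1 / 2) ^ h).trans_le
    (half_pow_le_norm_convDenom hq0 hq hz h))

lemma Dtilde_ne_zero {q z : ℂ} (hq0 : q ≠ 0) (hq : ‖q‖ ≤ 0.21) (hz : ‖z‖ ≤ 0.21) (j : ℕ) :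
    Dtilde q j z ≠ 0 := by
  rw [Dtilde_eq_mul]
  exact mul_ne_zero (convDenom_ne_zero hq0 hq hz j) (convDenom_ne_zero hq0 hq hz (j + 1))

lemma norm_seriesCoeff_le {q : ℂ} (hq0 : q ≠ 0) (hq : ‖q‖ ≤ 0.21) (j : ℕ) :
    ‖seriesCoeff q j‖ ≤ 2 := by
  induction j with
  | zero =>
    have := le_norm_one_sub hq
    rw [seriesCoeff_zero, norm_div, norm_one, div_le_iff₀ (by linarith)]
    linarith
  | succ j ih =>
    rw [seriesCoeff_succ hq0 (by linarith), norm_mul]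
    have := mul_le_mul (norm_abSeq_add_two_le hq0 hq j) ih (norm_nonneg _) zero_le_one
    linarith

/-- The terms of the series over `j` are dominated on the disc by a geometric series. -/
lemma norm_seriesCoeff_mul_pow_div_Dtilde_le {q z : ℂ} (hq0 : q ≠ 0) (hq : ‖q‖ ≤ 0.21)
    (hz : ‖z‖ ≤ 0.21) (j : ℕ) :
    ‖seriesCoeff q j * (z ^ (2 * j) / Dtilde q j z)‖ ≤ 4 * (1 / 4) ^ j := by
  have h1 := half_pow_le_norm_convDenom hq0 hq hz j
  have h2 := half_pow_le_norm_convDenom hq0 hq hz (j + 1)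
  rw [Dtilde_eq_mul, norm_mul, norm_div, norm_mul, norm_pow]
  calc _ ≤ 2 * ((0.21 : ℝ) ^ (2 * j) / ((1 / 2) ^ j * (1 / 2) ^ (j + 1))) := by
        gcongr
        exact norm_seriesCoeff_le hq0 hq j
    _ = 4 * ((0.21 : ℝ) ^ 2 / (1 / 2 * (1 / 2))) ^ j := by
        rw [pow_succ (1 / 2 : ℝ), div_pow (0.21 ^ 2 : ℝ), mul_pow, ← pow_mul]
        field_simp
        norm_num
    _ ≤ _ := mul_le_mul_of_nonneg_left
        (pow_le_pow_left₀ (by norm_num) (by norm_num) _) (by norm_num)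

lemma norm_moment_le {q : ℂ} (hq : ‖q‖ ≤ 0.21) (h n : ℕ) :
    ‖moment q h n‖ ≤ 2 * 1.1 ^ h := by
  have factor (k : ℕ) : ‖q ^ (k + 1) * (1 - q ^ (k + 1)) /
      ((1 - q ^ (2 * k + 1)) * (1 + q ^ (k + 1)))‖ ≤ 0.41 := by
    have n1 := norm_pow_le_of_norm_le hq (k := k + 1) (by omega)
    have a1 := le_norm_one_sub (norm_pow_le_of_norm_le hq (k := 2 * k + 1) (by omega))
    have a2 := le_norm_one_add n1
    have a3 := norm_one_sub_le n1
    rw [norm_div, norm_mul, norm_mul]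
    calc _ ≤ 0.21 * 1.21 / (0.79 * 0.79 : ℝ) := by gcongr
      _ ≤ 0.41 := by norm_num
  have coeff : ‖momentCoeff q h‖ ≤ 1.21 * 0.41 ^ h := by
    rw [momentCoeff, norm_mul, norm_prod]
    gcongr
    · exact norm_one_sub_le hq
    · refine (Finset.prod_le_prod (fun _ _ => norm_nonneg _) fun k _ => factor k).trans ?_
      simp
  have num : ‖∏ k ∈ Finset.range h, (q ^ k - q ^ n)‖ ≤ 2 ^ h := by
    rw [norm_prod]
    refine (Finset.prod_le_prod (fun _ _ => norm_nonneg _) (g := fun _ => 2) fun k _ => ?_).trans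
      (by simp)
    have le_one (i : ℕ) : ‖q ^ i‖ ≤ 1 := by
      rw [norm_pow]
      exact pow_le_one₀ (norm_nonneg q) (by linarith)
    have := norm_sub_le (q ^ k) (q ^ n)
    linarith [le_one k, le_one n]
  have den : 0.79 ^ (h + 1) ≤ ‖∏ k ∈ Finset.range (h + 1), (1 - q ^ (n + 1 + k))‖ := by
    rw [norm_prod]
    calc (0.79 : ℝ) ^ (h + 1) = ∏ k ∈ Finset.range (h + 1), 0.79 := by simp
      _ ≤ _ := Finset.prod_le_prod (fun _ _ => by norm_num) fun k _ =>
        le_norm_one_sub (norm_pow_le_of_norm_le hq (by omega))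
  rw [moment, norm_div, norm_mul]
  calc _ ≤ 1.21 * 0.41 ^ h * 2 ^ h / (0.79 : ℝ) ^ (h + 1) := by gcongr
    _ = 1.21 / 0.79 * (0.41 * 2 / 0.79) ^ h := by
        rw [div_pow, mul_pow, pow_succ]
        field_simp
    _ ≤ _ := by
        gcongr <;> norm_num

/-! ### The remainders of the J-fraction -/

/-- The remainder `F Q_h - P_h`, where `F = ∑ (1 - q) z^n / (1 - q^(n+1))` and `P_h` is the
numerator of the `h`-th convergent, as the power series of the moments. -/
noncomputable def remainder (q : ℂ) (h : ℕ) (z : ℂ) : ℂ :=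
  z ^ h * ∑' n, moment q h n * z ^ n

lemma norm_moment_mul_pow_le {q z : ℂ} (hq : ‖q‖ ≤ 0.21) (hz : ‖z‖ ≤ 0.21) (h n : ℕ) :
    ‖moment q h n * z ^ n‖ ≤ 2 * 1.1 ^ h * (1 / 2) ^ n := by
  rw [norm_mul, norm_pow]
  gcongr
  · exact norm_moment_le hq h n
  · linarith

lemma summable_moment_mul_pow {q z : ℂ} (hq : ‖q‖ ≤ 0.21) (hz : ‖z‖ ≤ 0.21) (h : ℕ) :
    Summable fun n => moment q h n * z ^ n :=
  .of_norm_bounded (summable_geometric_two.mul_left _) (norm_moment_mul_pow_le hq hz h)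

lemma norm_remainder_le {q z : ℂ} (hq : ‖q‖ ≤ 0.21) (hz : ‖z‖ ≤ 0.21) (h : ℕ) :
    ‖remainder q h z‖ ≤ 4 * (1 / 4) ^ h := by
  have := tsum_of_norm_bounded (hasSum_geometric_two.mul_left (2 * 1.1 ^ h))
    (norm_moment_mul_pow_le hq hz h)
  rw [remainder, norm_mul, norm_pow]
  calc _ ≤ (0.21 : ℝ) ^ h * (2 * 1.1 ^ h * 2) := by gcongr
    _ = 4 * (0.21 * 1.1 : ℝ) ^ h := by
        rw [mul_pow]
        ring
    _ ≤ _ := by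
        gcongr
        norm_num

lemma mul_tsum_moment_succ {q z : ℂ} (hq : ‖q‖ ≤ 0.21) (hz : ‖z‖ ≤ 0.21) (h : ℕ) :
    z * ∑' n, moment q h (n + 1) * z ^ n = ∑' n, moment q h n * z ^ n - moment q h 0 := by
  rw [(summable_moment_mul_pow hq hz h).tsum_eq_zero_add, pow_zero, mul_one, add_sub_cancel_left,
    ← tsum_mul_left]
  exact tsum_congr fun n => by ring

lemma summable_moment_succ_mul_pow {q z : ℂ} (hq : ‖q‖ ≤ 0.21) (hz : ‖z‖ ≤ 0.21) (h : ℕ) :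
    Summable fun n => moment q h (n + 1) * z ^ n := by
  refine .of_norm_bounded (summable_geometric_two.mul_left (2 * 1.1 ^ h)) fun n => ?_
  rw [norm_mul, norm_pow]
  gcongr
  · exact norm_moment_le hq h _
  · linarith

lemma remainder_one {q z : ℂ} (hq : ‖q‖ ≤ 0.21) (hz : ‖z‖ ≤ 0.21) :
    remainder q 1 z = (1 - cSeq q (q ^ 2) q 1 * z) * remainder q 0 z - 1 := by
  have hq1 : ‖q‖ < 1 := by linarith
  have h0 : moment q 0 0 = 1 := by
    have := one_sub_pow_ne_zero hq1 one_ne_zero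
    rw [moment_zero_left, zero_add, pow_one, div_self (by simpa using this)]
  have step : ∑' n, moment q 1 n * z ^ n = ∑' n, moment q 0 (n + 1) * z ^ n -
      cSeq q (q ^ 2) q 1 * ∑' n, moment q 0 n * z ^ n := by
    rw [← tsum_mul_left, ← (summable_moment_succ_mul_pow hq hz 0).tsum_sub
      ((summable_moment_mul_pow hq hz 0).mul_left _)]
    exact tsum_congr fun n => by
      rw [moment_one hq1]
      ring
  have shift := mul_tsum_moment_succ hq hz 0
  rw [h0] at shift
  rw [remainder, remainder, step]
  linear_combination shift

lemma remainder_add_two {q z : ℂ} (hq0 : q ≠ 0) (hq : ‖q‖ ≤ 0.21) (hz : ‖z‖ ≤ 0.21) (h : ℕ) :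
    remainder q (h + 2) z = (1 - cSeq q (q ^ 2) q (h + 2) * z) * remainder q (h + 1) z -
      abSeq q (q ^ 2) q (h + 2) * z ^ 2 * remainder q h z := by
  have hq1 : ‖q‖ < 1 := by linarith
  have step : ∑' n, moment q (h + 2) n * z ^ n = ∑' n, moment q (h + 1) (n + 1) * z ^ n -
      cSeq q (q ^ 2) q (h + 2) * ∑' n, moment q (h + 1) n * z ^ n -
      abSeq q (q ^ 2) q (h + 2) * ∑' n, moment q h n * z ^ n := by
    have s1 := (summable_moment_mul_pow hq hz (h + 1)).mul_left (cSeq q (q ^ 2) q (h + 2))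
    have s0 := (summable_moment_mul_pow hq hz h).mul_left (abSeq q (q ^ 2) q (h + 2))
    have s2 := summable_moment_succ_mul_pow hq hz (h + 1)
    rw [← tsum_mul_left, ← tsum_mul_left, ← s2.tsum_sub s1, ← (s2.sub s1).tsum_sub s0]
    exact tsum_congr fun n => by
      rw [moment_add_two hq0 hq1]
      ring
  have shift := mul_tsum_moment_succ hq hz (h + 1)
  rw [moment_succ_zero, sub_zero] at shift
  rw [remainder, remainder, remainder, step]
  linear_combination z ^ (h + 1) * shift

/-- The Casoratian of the two solutions `Q_h` and `remainder q h z` of the three-term recurrence is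
the product of its last coefficients `ab_i z²`. -/
lemma remainder_mul_convDenom_sub {q z : ℂ} (hq0 : q ≠ 0) (hq : ‖q‖ ≤ 0.21) (hz : ‖z‖ ≤ 0.21)
    (h : ℕ) :
    remainder q h z * convDenom (cSeq q (q ^ 2) q) (abSeq q (q ^ 2) q) z (h + 1) -
      remainder q (h + 1) z * convDenom (cSeq q (q ^ 2) q) (abSeq q (q ^ 2) q) z h =
    (1 - q) * seriesCoeff q h * z ^ (2 * h) := by
  have hq1 : ‖q‖ < 1 := by linarith
  induction h with
  | zero =>
    have := one_sub_pow_ne_zero hq1 one_ne_zero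
    rw [pow_one] at this
    rw [seriesCoeff_zero, zero_add, remainder_one hq hz, mul_one_div_cancel this]
    simp only [convDenom]
    ring
  | succ h ih =>
    rw [remainder_add_two hq0 hq hz, convDenom, seriesCoeff_succ hq0 hq1]
    linear_combination abSeq q (q ^ 2) q (h + 2) * z ^ 2 * ih

/-- The J-fraction expansion of `∑ z^n / (1 - q^(n+1))`, as the telescoping sum of the differences
of successive convergents. -/
lemma hasSum_seriesCoeff_mul {q z : ℂ} (hq0 : q ≠ 0) (hq : ‖q‖ ≤ 0.21) (hz : ‖z‖ ≤ 0.21) :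
    HasSum (fun j => seriesCoeff q j * (z ^ (2 * j) / Dtilde q j z))
      (∑' n : ℕ, z ^ n / (1 - q ^ (n + 1))) := by
  have hq1 : ‖q‖ < 1 := by linarith
  have ne := one_sub_pow_ne_zero hq1 one_ne_zero
  rw [pow_one] at ne
  have summ : Summable fun j => seriesCoeff q j * (z ^ (2 * j) / Dtilde q j z) :=
    .of_norm_bounded ((summable_geometric_of_lt_one (by norm_num) (by norm_num)).mul_left 4)
      (norm_seriesCoeff_mul_pow_div_Dtilde_le hq0 hq hz)
  have start : remainder q 0 z = (1 - q) * ∑' n : ℕ, z ^ n / (1 - q ^ (n + 1)) := by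
    rw [remainder, pow_zero, one_mul, ← tsum_mul_left]
    exact tsum_congr fun n => by
      rw [moment_zero_left]
      ring
  set ρ : ℕ → ℂ := fun h =>
    remainder q h z / convDenom (cSeq q (q ^ 2) q) (abSeq q (q ^ 2) q) z h with hρ
  have term (j : ℕ) : seriesCoeff q j * (z ^ (2 * j) / Dtilde q j z) =
      (1 - q)⁻¹ * (ρ j - ρ (j + 1)) := by
    have h0 := convDenom_ne_zero hq0 hq hz j
    have h1 := convDenom_ne_zero hq0 hq hz (j + 1)
    rw [eq_inv_mul_iff_mul_eq₀ ne, hρ, Dtilde_eq_mul]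
    simp only
    rw [div_sub_div _ _ h0 h1, mul_comm (convDenom _ _ z j) (remainder q (j + 1) z),
      remainder_mul_convDenom_sub hq0 hq hz]
    ring
  have lim : Filter.Tendsto ρ Filter.atTop (nhds 0) := by
    refine squeeze_zero_norm (a := fun h => 4 * (1 / 2) ^ h) (fun h => ?_) ?_
    · rw [hρ, norm_div]
      calc _ ≤ 4 * (1 / 4) ^ h / (1 / 2 : ℝ) ^ h := by
            gcongr
            · exact norm_remainder_le hq hz h
            · exact half_pow_le_norm_convDenom hq0 hq hz h
        _ = 4 * (1 / 2) ^ h := by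
            rw [mul_div_assoc, ← div_pow]
            norm_num
    · simpa using (tendsto_pow_atTop_nhds_zero_of_lt_one (r := (1 / 2 : ℝ))
        (by norm_num) (by norm_num)).const_mul 4
  refine (summ.hasSum_iff_tendsto_nat).2 ?_
  simp only [term, ← Finset.mul_sum, Finset.sum_range_sub']
  have zero : ρ 0 = (1 - q) * ∑' n : ℕ, z ^ n / (1 - q ^ (n + 1)) := by
    simp [hρ, convDenom, start]
  have := (lim.const_sub (ρ 0)).const_mul (1 - q)⁻¹
  rwa [sub_zero, zero, inv_mul_cancel_left₀ ne, ← zero] at this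

/-! ### Termwise differentiation -/

lemma differentiableOn_iteratedDeriv {f : ℂ → ℂ} {U : Set ℂ} (hU : IsOpen U)
    (hf : DifferentiableOn ℂ f U) (k : ℕ) : DifferentiableOn ℂ (iteratedDeriv k f) U := by
  induction k with
  | zero => simpa using hf
  | succ k ih =>
    rw [iteratedDeriv_succ]
    exact ih.deriv hU

lemma tendstoLocallyUniformlyOn_iteratedDeriv {ι : Type*} {φ : Filter ι} {F : ι → ℂ → ℂ}
    {f : ℂ → ℂ} {U : Set ℂ} (hU : IsOpen U) (hF : ∀ n, DifferentiableOn ℂ (F n) U)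
    (hf : TendstoLocallyUniformlyOn F f φ U) (k : ℕ) :
    TendstoLocallyUniformlyOn (fun n => iteratedDeriv k (F n)) (iteratedDeriv k f) φ U := by
  induction k with
  | zero => simpa using hf
  | succ k ih =>
    simp only [iteratedDeriv_succ]
    exact ih.deriv (.of_forall fun n => differentiableOn_iteratedDeriv hU (hF n) k) hU

lemma hasSum_iteratedDeriv_of_summable_norm {ι : Type*} {F : ι → ℂ → ℂ} {u : ι → ℝ} {U : Set ℂ}
    (hU : IsOpen U) (hu : Summable u) (hF : ∀ i, DifferentiableOn ℂ (F i) U)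
    (hle : ∀ i, ∀ w ∈ U, ‖F i w‖ ≤ u i) (k : ℕ) {z : ℂ} (hz : z ∈ U) :
    HasSum (fun i => iteratedDeriv k (F i) z) (iteratedDeriv k (fun w => ∑' i, F i w) z) := by
  have lim := (tendstoLocallyUniformlyOn_iteratedDeriv hU
    (fun s : Finset ι => DifferentiableOn.fun_sum fun i _ => hF i)
    (tendstoUniformlyOn_tsum hu hle).tendstoLocallyUniformlyOn k).tendsto_at hz
  refine lim.congr fun s => ?_
  exact iteratedDeriv_fun_sum fun i _ =>
    ((hF i).analyticAt (hU.mem_nhds hz)).contDiffAt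

/-! ### Stirling numbers and Lambert series -/

lemma pow_eq_sum_stirlingSecond_mul_descFactorial (x n : ℕ) :
    x ^ n = ∑ i ∈ Finset.range (n + 1), Nat.stirlingSecond n i * x.descFactorial i := by
  induction n with
  | zero => simp
  | succ n ih =>
    have mul_desc (i : ℕ) : x * x.descFactorial i =
        x.descFactorial (i + 1) + i * x.descFactorial i := by
      rw [Nat.descFactorial_succ, ← add_mul]
      rcases le_or_gt i x with h | h
      · rw [Nat.sub_add_cancel h]
      · rw [Nat.descFactorial_of_lt h, mul_zero, mul_zero]
    have shift : ∑ i ∈ Finset.range (n + 1), i * (Nat.stirlingSecond n i * x.descFactorial i) =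
        ∑ i ∈ Finset.range (n + 1),
          (i + 1) * (Nat.stirlingSecond n (i + 1) * x.descFactorial (i + 1)) := by
      rw [Finset.sum_range_succ', zero_mul, add_zero, Finset.sum_range_succ,
        Nat.stirlingSecond_eq_zero_of_lt (Nat.lt_succ_self n), zero_mul, mul_zero, add_zero]
    rw [Finset.sum_range_succ', Nat.stirlingSecond_succ_zero, zero_mul, add_zero, pow_succ, ih,
      Finset.sum_mul]
    calc _ = ∑ i ∈ Finset.range (n + 1), (Nat.stirlingSecond n i * x.descFactorial (i + 1) +
          i * (Nat.stirlingSecond n i * x.descFactorial i)) :=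
          Finset.sum_congr rfl fun i _ => by
            rw [mul_assoc, mul_comm _ x, mul_desc]
            ring
      _ = _ := by
          rw [Finset.sum_add_distrib, shift, ← Finset.sum_add_distrib]
          refine Finset.sum_congr rfl fun i _ => ?_
          rw [Nat.stirlingSecond_succ_succ]
          ring

lemma succ_pow_eq_sum_stirlingSecond_succ_mul_descFactorial (x n : ℕ) :
    (x + 1) ^ n =
      ∑ i ∈ Finset.range (n + 1), Nat.stirlingSecond (n + 1) (i + 1) * x.descFactorial i := by
  have := pow_eq_sum_stirlingSecond_mul_descFactorial (x + 1) (n + 1)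
  rw [Finset.sum_range_succ', Nat.stirlingSecond_succ_zero, zero_mul, add_zero, pow_succ'] at this
  refine Nat.eq_of_mul_eq_mul_left x.succ_pos (this.trans ?_)
  rw [Finset.mul_sum]
  exact Finset.sum_congr rfl fun i _ => by
    rw [Nat.succ_descFactorial_succ, Nat.succ_eq_add_one]
    ring

lemma summable_sigma_mul_pow (α : ℕ) {q : ℂ} (hq : ‖q‖ < 1) :
    Summable fun n : ℕ => (ArithmeticFunction.sigma α n : ℂ) * q ^ n := by
  refine .of_norm_bounded (summable_norm_pow_mul_geometric_of_norm_lt_one (α + 1) hq) fun n => ?_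
  rw [norm_mul, norm_mul, norm_pow (n : ℂ), Complex.norm_natCast, Complex.norm_natCast]
  gcongr
  exact_mod_cast ArithmeticFunction.sigma_le_pow_succ α n

/-- The Lambert series of `n^α` is the generating function of `σ_α`. -/
lemma tsum_sigma_mul_pow (α : ℕ) {q : ℂ} (hq : ‖q‖ < 1) :
    ∑' m : ℕ, (ArithmeticFunction.sigma α (m + 1) : ℂ) * q ^ (m + 1) =
      ∑' n : ℕ, ((n + 1 : ℕ) : ℂ) ^ α * q ^ (n + 1) / (1 - q ^ (n + 1)) := by
  rw [← tsum_pnat_eq_tsum_succ (f := fun m : ℕ => (ArithmeticFunction.sigma α m : ℂ) * q ^ m),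
    ← tsum_pnat_eq_tsum_succ (f := fun n : ℕ => (n : ℂ) ^ α * q ^ n / (1 - q ^ n))]
  exact (tsum_pow_div_one_sub_eq_tsum_sigma hq α).symm

/-! ### Derivatives of the J-fraction expansion -/

lemma differentiable_Dtilde (q : ℂ) (j : ℕ) : Differentiable ℂ (Dtilde q j) := by
  unfold Dtilde
  fun_prop

/-- Both `∑ z^(n+e) / (1 - q^(n+1))` and its J-fraction expansion may be differentiated term by
term. The exponents `e = 1` and `e = 0` give the two expansions of the divisor sums. -/
lemma exists_hasSum_iteratedDeriv {q z : ℂ} (hq0 : q ≠ 0) (hq : ‖q‖ ≤ 0.21) (hz : ‖z‖ < 0.21)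
    (e i : ℕ) :
    ∃ S : ℂ,
      HasSum (fun n : ℕ => ((n + e).descFactorial i : ℂ) * z ^ (n + e) / (1 - q ^ (n + 1))) S ∧
      HasSum (fun j : ℕ => seriesCoeff q j * z ^ i *
        iteratedDeriv i (fun w : ℂ => w ^ (2 * j + e) / Dtilde q j w) z) S := by
  have hq1 : ‖q‖ < 1 := by linarith
  have hU : IsOpen (Metric.ball (0 : ℂ) 0.21) := Metric.isOpen_ball
  have hzU : z ∈ Metric.ball (0 : ℂ) 0.21 := by simpa using hz
  have le_of_mem {w : ℂ} (hw : w ∈ Metric.ball (0 : ℂ) 0.21) : ‖w‖ ≤ 0.21 := by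
    simpa using (mem_ball_zero_iff.1 hw).le
  have pow_e {w : ℂ} (hw : w ∈ Metric.ball (0 : ℂ) 0.21) : ‖w ^ e‖ ≤ 1 := by
    rw [norm_pow]
    exact pow_le_one₀ (norm_nonneg w) (by linarith [le_of_mem hw])
  have sum_pow : HasSum
      (fun n : ℕ => iteratedDeriv i (fun w : ℂ => w ^ (n + e) / (1 - q ^ (n + 1))) z)
      (iteratedDeriv i (fun w : ℂ => ∑' n : ℕ, w ^ (n + e) / (1 - q ^ (n + 1))) z) := by
    refine hasSum_iteratedDeriv_of_summable_norm hU (summable_geometric_two.mul_left 2)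
      (fun n => by fun_prop) (fun n w hw => ?_) i hzU
    have hw' := le_of_mem hw
    have hd := le_norm_one_sub (norm_pow_le_of_norm_le hq n.succ_ne_zero)
    rw [pow_add, norm_div, norm_mul, norm_pow w n, div_le_iff₀ (by linarith)]
    calc ‖w‖ ^ n * ‖w ^ e‖ ≤ (1 / 2) ^ n * 1 := by
          gcongr
          · linarith
          · exact pow_e hw
      _ ≤ (1 / 2) ^ n * (2 * ‖1 - q ^ n.succ‖) := by
          gcongr
          linarith
      _ = _ := by ring
  have sum_frac : HasSum
      (fun j : ℕ => iteratedDeriv i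
        (fun w : ℂ => seriesCoeff q j * (w ^ (2 * j + e) / Dtilde q j w)) z)
      (iteratedDeriv i
        (fun w : ℂ => ∑' j : ℕ, seriesCoeff q j * (w ^ (2 * j + e) / Dtilde q j w)) z) := by
    refine hasSum_iteratedDeriv_of_summable_norm hU
      ((summable_geometric_of_lt_one (r := 1 / 4) (by norm_num) (by norm_num)).mul_left 4)
      (fun j => ?_) (fun j w hw => ?_) i hzU
    · refine DifferentiableOn.const_mul (DifferentiableOn.div (by fun_prop)
        (differentiable_Dtilde q j).differentiableOn fun w hw => ?_) _
      exact Dtilde_ne_zero hq0 hq (le_of_mem hw) j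
    · rw [show seriesCoeff q j * (w ^ (2 * j + e) / Dtilde q j w) =
        seriesCoeff q j * (w ^ (2 * j) / Dtilde q j w) * w ^ e by ring, norm_mul]
      exact (mul_le_of_le_one_right (norm_nonneg _) (pow_e hw)).trans
        (norm_seriesCoeff_mul_pow_div_Dtilde_le hq0 hq (le_of_mem hw) j)
  have agree : Set.EqOn (fun w : ℂ => ∑' n : ℕ, w ^ (n + e) / (1 - q ^ (n + 1)))
      (fun w : ℂ => ∑' j : ℕ, seriesCoeff q j * (w ^ (2 * j + e) / Dtilde q j w))
      (Metric.ball 0 0.21) := fun w hw => by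
    have h := (hasSum_seriesCoeff_mul hq0 hq (le_of_mem hw)).tsum_eq
    calc _ = w ^ e * ∑' n : ℕ, w ^ n / (1 - q ^ (n + 1)) := by
          rw [← tsum_mul_left]
          exact tsum_congr fun n => by ring
      _ = _ := by
          rw [← h, ← tsum_mul_left]
          exact tsum_congr fun j => by ring
  rw [agree.iteratedDeriv_of_isOpen hU i hzU] at sum_pow
  refine ⟨_, (sum_pow.mul_left (z ^ i)).congr_fun fun n => ?_,
    (sum_frac.mul_left (z ^ i)).congr_fun fun j => ?_⟩
  · rw [iteratedDeriv_div_const, iteratedDeriv_pow]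
    rcases le_or_gt i (n + e) with h | h
    · rw [← mul_div_assoc, mul_left_comm, ← pow_add, Nat.add_sub_cancel' h]
    · simp [Nat.descFactorial_of_lt h]
  · rw [iteratedDeriv_const_mul_field]
    ring

lemma Dtilde_zero {q : ℂ} (hq : ‖q‖ < 1) (w : ℂ) : Dtilde q 0 w = (1 + q - w) / (1 + q) := by
  have := one_add_pow_ne_zero hq one_ne_zero
  rw [pow_one] at this
  rw [Dtilde_eq_mul, zero_add]
  simp only [convDenom]
  rw [← zero_add 1, cSeq_succ hq]
  simp only [pow_zero, zero_add, pow_one]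
  field_simp
  ring

lemma seriesCoeff_zero_mul_pow_div_Dtilde {q : ℂ} (hq : ‖q‖ < 1) (e : ℕ) (w : ℂ) :
    seriesCoeff q 0 * (w ^ (2 * 0 + e) / Dtilde q 0 w) =
      w ^ e * (1 + q) / ((1 - q) * (1 + q - w)) := by
  rw [seriesCoeff_zero, Dtilde_zero hq, mul_zero, zero_add, div_div_eq_mul_div, one_div,
    inv_mul_eq_div, div_div, mul_comm (1 - q)]

lemma iteratedDeriv_const_div_sub (a b : ℂ) (i : ℕ) (z : ℂ) :
    iteratedDeriv i (fun w : ℂ => a / (b - w)) z = a * i.factorial / (b - z) ^ (i + 1) := by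
  have inv := congrFun (iter_deriv_inv_linear (𝕜 := ℂ) i (-1) b) z
  rw [← iteratedDeriv_eq_iterate] at inv
  have sub (w : ℂ) : b - w = -1 * w + b := by ring
  simp only [div_eq_mul_inv, sub]
  rw [iteratedDeriv_const_mul_field, inv, show (-1 - i : ℤ) = -((i + 1 : ℕ) : ℤ) by push_cast; ring,
    zpow_neg, zpow_natCast, mul_right_comm ((-1 : ℂ) ^ i), ← mul_pow, neg_one_mul, neg_neg, one_pow,
    one_mul, mul_assoc]

lemma termA_zero {q : ℂ} (hq : ‖q‖ < 1) (i : ℕ) (z : ℂ) :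
    termA q i 0 z = z ^ i *
      iteratedDeriv i (fun w : ℂ => w * (1 + q) / ((1 - q) * (1 + q - w))) z := by
  rw [termA, mul_right_comm, mul_comm, ← iteratedDeriv_const_mul_field]
  simp only [seriesCoeff_zero_mul_pow_div_Dtilde hq, pow_one]

lemma termB_zero {q : ℂ} (hq : ‖q‖ < 1) (i : ℕ) (z : ℂ) :
    termB q i 0 z =
      z ^ i * (i.factorial : ℂ) * (q * (1 + q)) / ((1 - q) * (1 + q - z) ^ (i + 1)) := by
  have base (w : ℂ) : q * seriesCoeff q 0 * (w ^ (2 * 0) / Dtilde q 0 w) =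
      q * (1 + q) / (1 - q) / (1 + q - w) := by
    rw [mul_assoc, ← add_zero (2 * 0), seriesCoeff_zero_mul_pow_div_Dtilde hq, pow_zero, one_mul,
      div_div, mul_div_assoc]
  rw [termB, mul_right_comm, mul_comm, ← iteratedDeriv_const_mul_field]
  simp only [base]
  rw [iteratedDeriv_const_div_sub, div_mul_eq_mul_div, div_div, mul_div_assoc']
  congr 1
  ring

/-- `∑ n^α q^n / (1 - q^n) = (z d/dz)^α ∑ z^n / (1 - q^n)` at `z = q`, where
`(z d/dz)^α = ∑ S(α, i) z^i D^i`. -/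
lemma hasSum_expansionA (α : ℕ) {q : ℂ} (hq : ‖q‖ < 1) {S : ℕ → ℂ}
    (hpow : ∀ i, HasSum
      (fun n : ℕ => ((n + 1).descFactorial i : ℂ) * q ^ (n + 1) / (1 - q ^ (n + 1))) (S i))
    (hS : ∀ i, HasSum (fun j => termA q i j q) (S i)) :
    HasSum (fun n : ℕ => ((n + 1 : ℕ) : ℂ) ^ α * q ^ (n + 1) / (1 - q ^ (n + 1)))
      (expansionA α q q) := by
  have value : expansionA α q q =
      ∑ i ∈ Finset.range (α + 1), (Nat.stirlingSecond α i : ℂ) * S i :=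
    Finset.sum_congr rfl fun i _ => by
      rw [← termA_zero hq, ← (hS i).tsum_eq, ← (hS i).summable.tsum_eq_zero_add]
  rw [value]
  refine (hasSum_sum fun i _ => (hpow i).mul_left _).congr_fun fun n => ?_
  rw [← Nat.cast_pow, pow_eq_sum_stirlingSecond_mul_descFactorial, Nat.cast_sum, Finset.sum_mul,
    Finset.sum_div]
  refine Finset.sum_congr rfl fun i _ => ?_
  rw [Nat.cast_mul, mul_assoc, mul_div_assoc]

/-- `∑ (n + 1)^α q^(n+1) / (1 - q^(n+1)) = (z d/dz + 1)^α ∑ q z^n / (1 - q^(n+1))` at `z = q`, where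
`(z d/dz + 1)^α = ∑ S(α + 1, i + 1) z^i D^i`. -/
lemma hasSum_expansionB (α : ℕ) {q : ℂ} (hq : ‖q‖ < 1) {S : ℕ → ℂ}
    (hpow : ∀ i, HasSum
      (fun n : ℕ => q * ((n.descFactorial i : ℂ) * q ^ n / (1 - q ^ (n + 1)))) (S i))
    (hS : ∀ i, HasSum (fun j => termB q i j q) (S i)) :
    HasSum (fun n : ℕ => ((n + 1 : ℕ) : ℂ) ^ α * q ^ (n + 1) / (1 - q ^ (n + 1)))
      (expansionB α q q) := by
  have value : expansionB α q q =
      ∑ i ∈ Finset.range (α + 1), (Nat.stirlingSecond (α + 1) (i + 1) : ℂ) * S i :=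
    Finset.sum_congr rfl fun i _ => by
      rw [← termB_zero hq, ← (hS i).tsum_eq, ← (hS i).summable.tsum_eq_zero_add]
  rw [value]
  refine (hasSum_sum fun i _ => (hpow i).mul_left _).congr_fun fun n => ?_
  rw [← Nat.cast_pow, succ_pow_eq_sum_stirlingSecond_succ_mul_descFactorial, Nat.cast_sum,
    Finset.sum_mul, Finset.sum_div]
  refine Finset.sum_congr rfl fun i _ => ?_
  rw [Nat.cast_mul, pow_succ']
  simp only [div_eq_mul_inv]
  ring

end JFrac

open JFrac in
theorem mainTheorem4 (α : ℕ) (hα : 1 ≤ α) (q : ℂ) (hq0 : 0 < ‖q‖) (hq1 : ‖q‖ < 0.206783) :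
    (∀ j : ℕ, 1 ≤ j → ∀ z : ℂ, Dtilde q j z =
      convDenom (cSeq q (q ^ 2) q) (abSeq q (q ^ 2) q) z j *
        convDenom (cSeq q (q ^ 2) q) (abSeq q (q ^ 2) q) z (j + 1)) ∧
    (∀ j : ℕ, 1 ≤ j → Dtilde q j q ≠ 0) ∧
    (∀ i : ℕ, Summable (fun j : ℕ => termA q i (j + 1) q)) ∧
    (∀ i : ℕ, Summable (fun j : ℕ => termB q i (j + 1) q)) ∧
    ∃ D : ℂ,
      HasSum (fun m : ℕ => (ArithmeticFunction.sigma α (m + 1) : ℂ) * q ^ (m + 1)) D ∧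
      HasSum (fun n : ℕ => ((n + 1 : ℕ) : ℂ) ^ α * q ^ (n + 1) / (1 - q ^ (n + 1))) D ∧
      D = expansionA α q q ∧
      D = expansionB α q q := by
  have hq : q ≠ 0 := norm_pos_iff.1 hq0
  -- The disc of radius `0.21` is a neighbourhood of `q`, so that derivatives can be taken there.
  have hlt : ‖q‖ < 0.21 := by linarith
  have hlt1 : ‖q‖ < 1 := by linarith
  choose SA powA fracA using exists_hasSum_iteratedDeriv hq hlt.le hlt 1
  choose SB powB fracB using exists_hasSum_iteratedDeriv hq hlt.le hlt 0
  have hA (i : ℕ) : HasSum (fun j => termA q i j q) (SA i) := fracA i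
  have hB (i : ℕ) : HasSum (fun j => termB q i j q) (q * SB i) :=
    ((fracB i).mul_left q).congr_fun fun j => by
      rw [termB, add_zero]
      ring
  have sumA := hasSum_expansionA α hlt1 powA hA
  have sumB := hasSum_expansionB α hlt1 (fun i => (powB i).mul_left q) hB
  have lambert : HasSum (fun m : ℕ => (ArithmeticFunction.sigma α (m + 1) : ℂ) * q ^ (m + 1))
      (expansionA α q q) := by
    rw [← sumA.tsum_eq, ← tsum_sigma_mul_pow α hlt1]
    exact ((summable_nat_add_iff 1).2 (summable_sigma_mul_pow α hlt1)).hasSum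
  have summA (i : ℕ) : Summable fun j => termA q i (j + 1) q :=
    (summable_nat_add_iff (f := fun j => termA q i j q) 1).2 (hA i).summable
  have summB (i : ℕ) : Summable fun j => termB q i (j + 1) q :=
    (summable_nat_add_iff (f := fun j => termB q i j q) 1).2 (hB i).summable
  exact ⟨fun j _ z => Dtilde_eq_mul q j z, fun j _ => Dtilde_ne_zero hq hlt.le hlt.le j,
    summA, summB, expansionA α q q, lambert, sumA, rfl, sumA.unique sumB⟩
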